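/- For $1\le k<n$ let $G(k,n)$ be the Grassmannian of $k$-dimensional linear subspaces of $\mathbb R^n$, with the metric $d(V,W)=\|\pi_V-\pi_W\|$, where $\pi_V:\mathbb R^n\to V$ denotes the orthogonal projection onto $V$ (regarded as an operator on $\mathbb R^n$ in the formula for $d$). Let $\dim$ denote Hausdorff dimension (with $\dim\emptyset=0$), and for $0<s<\min\{k,a\}$ put $$T(a,s)=\sup\bigl\{\dim\{V\in G(k,n):\dim \pi_V(A)<s\}\;:\;A\subset\mathbb R^n\text{ Borel},\ \dim A=a\bigr\}.$$ Let $k=1$ and $n=3$ (projections onto lines in $\mathbb R^3$), and let $0<s<\min\{1,a\}$. Then: 1. If $a\le 1$, then $T(a,s)\ge 1$. 2. If $1<a\le 2$, then $$T(a,s)\ge\begin{cases}0, & s\le\frac{a-1}{2},\\ 1+2s-a, & \frac{a-1}{2}<s\le a-1,\\ 1, & a-1<s<1.\end{cases}$$ 3. If $2<a\le 3$, then $$T(a,s)\ge\begin{cases}0, & s\le\frac{a-1}{2},\\ 1+2s-a, & \frac{a-1}{2}<s<1.\end{cases}$$ -/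

import Mathlib

open scoped ENNReal

/-- The Grassmannian `G(k,n)`: the set of `k`-dimensional linear subspaces of `ℝⁿ`. -/
def Grassmannian (k n : ℕ) : Type :=
  {V : Submodule ℝ (EuclideanSpace ℝ (Fin n)) // Module.finrank ℝ V = k}

namespace Grassmannian

/-- The orthogonal projection onto `V`, as an operator on `ℝⁿ`. -/
noncomputable def projOperator {k n : ℕ} (V : Grassmannian k n) :
    EuclideanSpace ℝ (Fin n) →L[ℝ] EuclideanSpace ℝ (Fin n) :=
  V.1.starProjection

theorem projOperator_injective {k n : ℕ} :
    Function.Injective (projOperator : Grassmannian k n → _) := fun _ _ h =>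
  Subtype.ext (Submodule.starProjection_inj.1 h)

/-- The usual metric on the Grassmannian: `d(V, W) = ‖π_V - π_W‖` (operator norm). -/
noncomputable instance (k n : ℕ) : MetricSpace (Grassmannian k n) :=
  MetricSpace.induced projOperator projOperator_injective inferInstance

end Grassmannian

/-- The exceptional set `E_s(A) = {V ∈ G(k,n) : dim π_V(A) < s}`, where `π_V : ℝⁿ → V` is the
orthogonal projection and `dim` is the Hausdorff dimension. -/
def exceptionalSet (k n : ℕ) (s : ℝ) (A : Set (EuclideanSpace ℝ (Fin n))) :
    Set (Grassmannian k n) :=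
  {V | dimH (V.1.orthogonalProjectionOnto '' A) < ENNReal.ofReal s}

/-- `T(a,s)`: the supremum of the Hausdorff dimension of `E_s(A)` over all Borel sets `A ⊆ ℝⁿ`
of Hausdorff dimension `a`. -/
noncomputable def exceptionalDim (k n : ℕ) (a s : ℝ) : ℝ≥0∞ :=
  ⨆ (A : Set (EuclideanSpace ℝ (Fin n))) (_ : MeasurableSet A) (_ : dimH A = ENNReal.ofReal a),
    dimH (exceptionalSet k n s A)

/-! Only lines of slope `θ` in the plane of the first two coordinates are used. For them the
projection is, up to scaling, `x 0 + θ * x 1`, so the third coordinate of `A` adds to its dimension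
without being seen.

The building block is `sparseSet u`: binary digits are forced to be zero on the gaps `[⌈u * j!⌉,
j!)`. At scale `2 ^ (-j!)` it lies just above multiples of `2 ^ (-u * j!)`, so its dimension is at
most `u`. Since `(j - 1)!` is negligible against `j!`, digit counting and the mass distribution
principle give equality. All these sets share the scales `j!`, so dimensions add in products.

Where the bound is `1`, a box whose second factor is `{0}` suffices: every slope sees only the first
factor. For the intermediate bound put `t = a - 1` and take factors of dimensions `r`, `t - r` and
`1`, with `r < s`. If `θ ∈ sparseSet (2 * r - t)`, then `θ * x 1` lies near the grid of exponent `(t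
- r) + (2 * r - t) = r`, which is the grid of `x 0`. So the sum has dimension at most `r`
(`dimH_sparseSet_add_mul_le`), and `r → s` gives `2 * s - t = 1 + 2 * s - a`. -/

open MeasureTheory Filter Topology

/-! ### Bounds for the Hausdorff dimension -/

/-- A set that is covered, at scales `2 ^ (-m j) → 0`, by at most `C * 2 ^ (d * m j)` sets of
diameter at most `C * 2 ^ (-m j)` has Hausdorff dimension at most `d`. -/
theorem dimH_le_of_forall_cover {X : Type*} [MetricSpace X] {E : Set X} {d C : ℝ} (hd : 0 ≤ d)
    (hC : 0 ≤ C) {m : ℕ → ℕ} (hm : Tendsto m atTop atTop) {ι : ℕ → Type} [∀ j, Fintype (ι j)]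
    (t : ∀ j, ι j → Set X) (hcov : ∀ j, E ⊆ ⋃ i, t j i)
    (hcard : ∀ j, (Fintype.card (ι j) : ℝ) ≤ C * 2 ^ (d * m j))
    (hdiam : ∀ j i, Metric.ediam (t j i) ≤ ENNReal.ofReal (C * (2 ^ m j)⁻¹)) :
    dimH E ≤ ENNReal.ofReal d := by
  borelize X
  have hr : Tendsto (fun j ↦ ENNReal.ofReal (C * (2 ^ m j)⁻¹)) atTop (𝓝 0) := by
    rw [← ENNReal.ofReal_zero]
    refine (ENNReal.continuous_ofReal.tendsto 0).comp ?_
    have h := (tendsto_pow_atTop_nhds_zero_of_lt_one (r := (2 : ℝ)⁻¹) (by norm_num)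
      (by norm_num)).comp hm
    simpa using h.const_mul C
  have key : Measure.hausdorffMeasure d E ≤ ENNReal.ofReal (C * C ^ d) := by
    refine (Measure.hausdorffMeasure_le_liminf_sum d E _ hr t
      (Eventually.of_forall hdiam) (Eventually.of_forall hcov)).trans ?_
    refine liminf_le_of_le (by isBoundedDefault) fun b hb ↦ ?_
    obtain ⟨j, hj⟩ := hb.exists
    refine hj.trans ?_
    calc ∑ i, Metric.ediam (t j i) ^ d
        ≤ ∑ _i : ι j, ENNReal.ofReal (C * (2 ^ m j)⁻¹) ^ d :=
          Finset.sum_le_sum fun i _ ↦ ENNReal.rpow_le_rpow (hdiam j i) hd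
      _ = ENNReal.ofReal (Fintype.card (ι j) * (C * (2 ^ m j)⁻¹) ^ d) := by
          rw [ENNReal.ofReal_rpow_of_nonneg (by positivity) hd,
            ENNReal.ofReal_mul (by positivity)]
          simp
      _ ≤ ENNReal.ofReal (C * C ^ d) := by
          apply ENNReal.ofReal_le_ofReal
          calc Fintype.card (ι j) * (C * (2 ^ m j)⁻¹) ^ d
              ≤ (C * 2 ^ (d * m j)) * (C * (2 ^ m j)⁻¹) ^ d := by
                gcongr
                exact hcard j
            _ = C * C ^ d := by
                rw [Real.mul_rpow hC (by positivity), Real.inv_rpow (by positivity),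
                  ← Real.rpow_natCast, ← Real.rpow_mul (by norm_num), mul_comm (m j : ℝ) d]
                have : (2 : ℝ) ^ (d * m j) ≠ 0 := by positivity
                field_simp
  have := dimH_le_of_hausdorffMeasure_ne_top (s := E) (d := d.toNNReal)
    (by rw [Real.coe_toNNReal d hd]; exact (key.trans_lt ENNReal.ofReal_lt_top).ne)
  exact this

/-- The mass distribution principle, at dyadic scales. -/
theorem le_dimH_of_forall_measure_le {X : Type*} [MetricSpace X] [MeasurableSpace X]
    [BorelSpace X] {E : Set X} (μ : Measure X) (hE : μ E ≠ 0) {d C : ℝ} (hd : 0 < d)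
    (h : ∀ (n : ℕ) (U : Set X), Metric.ediam U ≤ ENNReal.ofReal (2 ^ n)⁻¹ →
      μ U ≤ ENNReal.ofReal (C * 2 ^ (-(d * n)))) :
    ENNReal.ofReal d ≤ dimH E := by
  by_contra! hlt
  have hzero : Measure.hausdorffMeasure d E = 0 := by
    have := hausdorffMeasure_of_dimH_lt (s := E) (d := d.toNNReal) hlt
    rwa [Real.coe_toNNReal d hd.le] at this
  -- The factor `2 ^ d` pays for rounding a diameter up to a dyadic scale; `+ 1` keeps `K` positive
  -- when `C = 0`.
  set K : ℝ := |C| * 2 ^ d + 1 with hK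
  have hKpos : 0 < K := by positivity
  have hle : (ENNReal.ofReal K)⁻¹ • μ ≤ Measure.hausdorffMeasure d := by
    refine Measure.le_hausdorffMeasure d _ 1 one_pos fun U hU ↦ ?_
    have hfin : Metric.ediam U ≠ ⊤ := (hU.trans_lt ENNReal.one_lt_top).ne
    suffices μ U ≤ ENNReal.ofReal K * Metric.ediam U ^ d by
      rw [Measure.smul_apply, smul_eq_mul, mul_comm, ← div_eq_mul_inv]
      exact ENNReal.div_le_of_le_mul' this
    rcases eq_or_ne (Metric.ediam U) 0 with h0 | h0
    · have hlim : Tendsto (fun n : ℕ ↦ ENNReal.ofReal (C * 2 ^ (-(d * n)))) atTop (𝓝 0) := by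
        rw [← ENNReal.ofReal_zero]
        refine (ENNReal.continuous_ofReal.tendsto 0).comp ?_
        have h2 := (tendsto_pow_atTop_nhds_zero_of_lt_one (r := (2 : ℝ) ^ (-d)) (by positivity)
          (Real.rpow_lt_one_of_one_lt_of_neg (by norm_num) (by linarith))).const_mul C
        refine (mul_zero C ▸ h2).congr fun n ↦ ?_
        rw [← Real.rpow_natCast, ← Real.rpow_mul (by norm_num), neg_mul]
      have : μ U ≤ 0 := ge_of_tendsto' hlim fun n ↦ h n U (by simp [h0])
      exact this.trans zero_le
    · set r := (Metric.ediam U).toReal with hr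
      have hUr : Metric.ediam U = ENNReal.ofReal r := (ENNReal.ofReal_toReal hfin).symm
      have hr0 : 0 < r := ENNReal.toReal_pos h0 hfin
      have hr1 : r ≤ 1 := by simpa using ENNReal.toReal_mono ENNReal.one_ne_top hU
      obtain ⟨n, hn1, hn2⟩ := exists_nat_pow_near_of_lt_one hr0 hr1 (y := (2 : ℝ)⁻¹) (by norm_num)
        (by norm_num)
      refine (h n U ?_).trans ?_
      · rw [hUr]
        apply ENNReal.ofReal_le_ofReal
        simpa using hn2
      · rw [hUr, ENNReal.ofReal_rpow_of_nonneg hr0.le hd.le, ← ENNReal.ofReal_mul hKpos.le]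
        apply ENNReal.ofReal_le_ofReal
        have h3 : (2 : ℝ) ^ (-(d * n)) ≤ 2 ^ d * r ^ d := by
          rw [← Real.mul_rpow (by norm_num) hr0.le]
          have h4 : (2 : ℝ)⁻¹ ^ n ≤ 2 * r := by
            rw [pow_succ] at hn1
            linarith
          calc (2 : ℝ) ^ (-(d * n)) = ((2 : ℝ)⁻¹ ^ n) ^ d := by
                rw [← Real.rpow_natCast, ← Real.rpow_mul (by norm_num), Real.inv_rpow (by norm_num),
                  ← Real.rpow_neg (by norm_num), mul_comm]
            _ ≤ _ := Real.rpow_le_rpow (by positivity) h4 hd.le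
        calc C * 2 ^ (-(d * n)) ≤ |C| * (2 ^ d * r ^ d) := by
              gcongr
              exact le_abs_self C
          _ ≤ K * r ^ d := by
              rw [hK]
              nlinarith [Real.rpow_nonneg hr0.le d]
  have h5 : (ENNReal.ofReal K)⁻¹ * μ E ≤ 0 := by
    have := hle E
    rwa [hzero] at this
  rw [nonpos_iff_eq_zero, mul_eq_zero] at h5
  rcases h5 with h5 | h5
  · simp at h5
  · exact hE h5

/-! ### Sets of reals with prescribed binary digits -/

/-- The natural number whose binary expansion consists of the first `n` digits of `ω`. -/
def digitPrefix (ω : ℕ → Fin 2) : ℕ → ℕ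
  | 0 => 0
  | n + 1 => 2 * digitPrefix ω n + ω n

theorem digitPrefix_lt (ω : ℕ → Fin 2) (n : ℕ) : digitPrefix ω n < 2 ^ n := by
  induction n with
  | zero => simp [digitPrefix]
  | succ n ih =>
    have := (ω n).isLt
    rw [digitPrefix, pow_succ]
    omega

theorem eq_of_digitPrefix_eq {ω ω' : ℕ → Fin 2} {n : ℕ}
    (h : digitPrefix ω n = digitPrefix ω' n) : ∀ i < n, ω i = ω' i := by
  induction n with
  | zero => simp
  | succ n ih =>
    have h1 := (ω n).isLt
    have h2 := (ω' n).isLt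
    simp only [digitPrefix] at h
    intro i hi
    rcases Nat.lt_succ_iff_lt_or_eq.1 hi with hi | rfl
    · exact ih (by omega) i hi
    · exact Fin.ext (by omega)

theorem digitPrefix_of_gap {ω : ℕ → Fin 2} {p m : ℕ} (hpm : p ≤ m)
    (h : ∀ i, p ≤ i → i < m → ω i = 0) : digitPrefix ω m = 2 ^ (m - p) * digitPrefix ω p := by
  induction m, hpm using Nat.le_induction with
  | base => simp
  | succ m hpm ih =>
    rw [digitPrefix, ih fun i h1 h2 ↦ h i h1 (by omega), h m hpm (by omega),
      Nat.sub_add_comm hpm, pow_succ]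
    simp
    ring

theorem sum_ofDigitsTerm_eq (ω : ℕ → Fin 2) (n : ℕ) :
    ∑ i ∈ Finset.range n, Real.ofDigitsTerm ω i = digitPrefix ω n / 2 ^ n := by
  induction n with
  | zero => simp [digitPrefix]
  | succ n ih =>
    rw [Finset.sum_range_succ, ih, Real.ofDigitsTerm, digitPrefix, pow_succ]
    push_cast
    field_simp
    ring

theorem ofDigits_mem_Icc (ω : ℕ → Fin 2) (n : ℕ) :
    Real.ofDigits ω ∈ Set.Icc (digitPrefix ω n / 2 ^ n : ℝ)
      (digitPrefix ω n / 2 ^ n + (2 ^ n)⁻¹) := by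
  rw [Real.ofDigits_eq_sum_add_ofDigits ω n, sum_ofDigitsTerm_eq]
  have h0 := Real.ofDigits_nonneg fun i ↦ ω (i + n)
  have h1 := Real.ofDigits_le_one fun i ↦ ω (i + n)
  push_cast
  constructor
  · have : 0 ≤ ((2 : ℝ) ^ n)⁻¹ * Real.ofDigits fun i ↦ ω (i + n) := by positivity
    linarith
  · have : ((2 : ℝ) ^ n)⁻¹ * (Real.ofDigits fun i ↦ ω (i + n)) ≤ (2 ^ n)⁻¹ :=
      mul_le_of_le_one_right (by positivity) h1
    linarith

/-- The set of reals in `[0, 1]` with a binary expansion that vanishes at all positions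
outside `S`. -/
def digitSet (S : Set ℕ) : Set ℝ :=
  Real.ofDigits '' {ω : ℕ → Fin 2 | ∀ i ∉ S, ω i = 0}

theorem isClosed_setOf_digits_eq_zero (S : Set ℕ) :
    IsClosed {ω : ℕ → Fin 2 | ∀ i ∉ S, ω i = 0} := by
  have : {ω : ℕ → Fin 2 | ∀ i ∉ S, ω i = 0} = ⋂ i, ⋂ (_ : i ∉ S), {ω | ω i = 0} := by
    ext; simp
  rw [this]
  exact isClosed_iInter fun i ↦ isClosed_iInter fun _ ↦
    isClosed_eq (continuous_apply i) continuous_const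

theorem isCompact_digitSet (S : Set ℕ) : IsCompact (digitSet S) :=
  (isClosed_setOf_digits_eq_zero S).isCompact.image Real.continuous_ofDigits

theorem digitSet_subset_Icc (S : Set ℕ) : digitSet S ⊆ Set.Icc 0 1 := by
  rintro _ ⟨ω, -, rfl⟩
  exact ⟨Real.ofDigits_nonneg ω, Real.ofDigits_le_one ω⟩

/-- Points of `digitSet S` lie just above multiples of `2 ^ (-p)` when `S` has a gap `[p, m)`. -/
theorem exists_of_mem_digitSet {S : Set ℕ} {p m : ℕ} (hpm : p ≤ m)
    (hS : ∀ i, p ≤ i → i < m → i ∉ S) {x : ℝ} (hx : x ∈ digitSet S) :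
    ∃ k : ℕ, k < 2 ^ p ∧ x ∈ Set.Icc (k / 2 ^ p : ℝ) (k / 2 ^ p + (2 ^ m)⁻¹) := by
  obtain ⟨ω, hω, rfl⟩ := hx
  refine ⟨digitPrefix ω p, digitPrefix_lt ω p, ?_⟩
  have h := ofDigits_mem_Icc ω m
  rw [digitPrefix_of_gap hpm fun i h1 h2 ↦ hω i (hS i h1 h2)] at h
  have h2 : ((2 ^ (m - p) * digitPrefix ω p : ℕ) : ℝ) / 2 ^ m = digitPrefix ω p / 2 ^ p := by
    obtain ⟨c, rfl⟩ := Nat.exists_eq_add_of_le hpm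
    rw [Nat.add_sub_cancel_left, pow_add]
    push_cast
    field_simp
  rwa [h2] at h

open Classical in
/-- The law of one digit: a fair coin at the positions in `S`, and `0` elsewhere. -/
noncomputable def digitLaw (S : Set ℕ) (i : ℕ) : Measure (Fin 2) :=
  if i ∈ S then (PMF.uniformOfFintype (Fin 2)).toMeasure else Measure.dirac 0

instance (S : Set ℕ) (i : ℕ) : IsProbabilityMeasure (digitLaw S i) := by
  unfold digitLaw
  split_ifs <;> infer_instance

/-- The law of a random element of `digitSet S` with independent fair digits at the positions
in `S`. -/
noncomputable def digitMeasure (S : Set ℕ) : Measure ℝ :=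
  (Measure.infinitePi (digitLaw S)).map Real.ofDigits

instance (S : Set ℕ) : IsProbabilityMeasure (digitMeasure S) :=
  Measure.isProbabilityMeasure_map Real.continuous_ofDigits.measurable.aemeasurable

theorem digitMeasure_digitSet (S : Set ℕ) : digitMeasure S (digitSet S) = 1 := by
  refine le_antisymm prob_le_one ?_
  rw [digitMeasure, Measure.map_apply Real.continuous_ofDigits.measurable
    (isCompact_digitSet S).measurableSet]
  refine le_trans (le_of_eq ?_) (measure_mono (Set.subset_preimage_image _ _))
  symm
  have hnull : ∀ᵐ ω ∂(Measure.infinitePi (digitLaw S)), ∀ i ∉ S, ω i = 0 := by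
    rw [ae_all_iff]
    intro i
    by_cases hi : i ∈ S
    · simp [hi]
    · have h := (measurePreserving_eval_infinitePi (digitLaw S) i).quasiMeasurePreserving.ae
        (p := fun a ↦ a = 0) (by simp [digitLaw, hi])
      filter_upwards [h] with ω hω _ using hω
  rw [← prob_compl_eq_zero_iff₀]
  · exact hnull
  · exact (isClosed_setOf_digits_eq_zero S).measurableSet.nullMeasurableSet

-- A prefix fixes each of the first `n` digits, so the event lies in a cylinder, and each free digit
-- costs a factor `1/2`.
open Classical in
theorem infinitePi_digitLaw_digitPrefix_eq_le (S : Set ℕ) (n k : ℕ) :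
    Measure.infinitePi (digitLaw S) {ω | digitPrefix ω n = k} ≤
      2⁻¹ ^ Nat.count (· ∈ S) n := by
  rcases Set.eq_empty_or_nonempty {ω : ℕ → Fin 2 | digitPrefix ω n = k} with h | ⟨ω₀, hω₀⟩
  · simp [h]
  · have hsub : {ω : ℕ → Fin 2 | digitPrefix ω n = k} ⊆
        Set.pi (Finset.range n) fun i ↦ {ω₀ i} := fun ω hω i hi ↦
      eq_of_digitPrefix_eq (Eq.trans hω hω₀.symm) i (by simpa using hi)
    refine (measure_mono hsub).trans ?_
    rw [Measure.infinitePi_pi _ fun i _ ↦ measurableSet_singleton _, Nat.count_eq_card_filter_range,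
      ← Finset.prod_const, Finset.prod_filter]
    refine Finset.prod_le_prod' fun i _ ↦ ?_
    split_ifs with hi
    · simp [digitLaw, hi]
    · exact prob_le_one

-- A set of diameter at most `2 ^ (-n)` meets dyadic intervals of that length for at most four
-- consecutive prefixes, two of them because endpoints may be touched.
open Classical in
theorem digitMeasure_le (S : Set ℕ) (n : ℕ) {U : Set ℝ}
    (hU : Metric.ediam U ≤ ENNReal.ofReal (2 ^ n)⁻¹) :
    digitMeasure S U ≤ 4 * 2⁻¹ ^ Nat.count (· ∈ S) n := by
  rcases U.eq_empty_or_nonempty with rfl | ⟨x, hx⟩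
  · simp
  have hsub : U ⊆ Set.Icc (x - (2 ^ n)⁻¹) (x + (2 ^ n)⁻¹) := by
    intro y hy
    have h := (Metric.edist_le_ediam_of_mem hy hx).trans hU
    rw [edist_dist, ENNReal.ofReal_le_ofReal_iff (by positivity), Real.dist_eq, abs_le] at h
    constructor <;> linarith
  have hpre : Real.ofDigits ⁻¹' Set.Icc (x - (2 ^ n)⁻¹) (x + (2 ^ n)⁻¹) ⊆
      ⋃ l ∈ Finset.range 4, {ω : ℕ → Fin 2 | digitPrefix ω n = (⌊2 ^ n * x⌋ - 2 + l).toNat} := by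
    intro ω hω
    obtain ⟨h1, h2⟩ := hω
    obtain ⟨h3, h4⟩ := ofDigits_mem_Icc ω n
    have hpos : (0 : ℝ) < 2 ^ n := by positivity
    have h5 : (digitPrefix ω n : ℝ) ≤ 2 ^ n * x + 1 := by
      have := h3.trans h2
      rw [div_le_iff₀ hpos, add_mul, inv_mul_cancel₀ hpos.ne'] at this
      linarith
    have h6 : 2 ^ n * x ≤ digitPrefix ω n + 2 := by
      have : x ≤ digitPrefix ω n / 2 ^ n + (2 ^ n)⁻¹ + (2 ^ n)⁻¹ := by linarith
      have := mul_le_mul_of_nonneg_left this hpos.le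
      rw [mul_add, mul_add, mul_inv_cancel₀ hpos.ne', mul_div_cancel₀ _ hpos.ne'] at this
      linarith
    have h7 : (digitPrefix ω n : ℤ) - 1 ≤ ⌊2 ^ n * x⌋ := by
      rw [Int.le_floor]
      push_cast
      linarith
    have h8 : ⌊2 ^ n * x⌋ ≤ digitPrefix ω n + 2 := by
      have : (⌊2 ^ n * x⌋ : ℝ) ≤ ((digitPrefix ω n + 2 : ℤ) : ℝ) := by
        push_cast
        exact (Int.floor_le _).trans h6
      exact_mod_cast this
    simp only [Set.mem_iUnion, Finset.mem_range, Set.mem_ofPred_eq, exists_prop]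
    exact ⟨(digitPrefix ω n - (⌊2 ^ n * x⌋ - 2)).toNat, by omega, by omega⟩
  calc digitMeasure S U ≤ digitMeasure S (Set.Icc (x - (2 ^ n)⁻¹) (x + (2 ^ n)⁻¹)) :=
        measure_mono hsub
    _ = Measure.infinitePi (digitLaw S)
          (Real.ofDigits ⁻¹' Set.Icc (x - (2 ^ n)⁻¹) (x + (2 ^ n)⁻¹)) :=
        Measure.map_apply Real.continuous_ofDigits.measurable measurableSet_Icc
    _ ≤ _ := (measure_mono hpre).trans (measure_biUnion_finset_le _ _)
    _ ≤ ∑ _l ∈ Finset.range 4, 2⁻¹ ^ Nat.count (· ∈ S) n :=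
        Finset.sum_le_sum fun l _ ↦ infinitePi_digitLaw_digitPrefix_eq_le S n _
    _ = _ := by simp

/-! ### Digit sets of prescribed dimension -/

/-- The positions outside the gaps `[⌈u * j!⌉, j!)`. -/
def sparsePositions (u : ℝ) : Set ℕ :=
  {i | ∀ j : ℕ, ⌈u * (j.factorial : ℝ)⌉₊ ≤ i → j.factorial ≤ i}

theorem tendsto_factorial_atTop : Tendsto Nat.factorial atTop atTop :=
  tendsto_atTop_mono Nat.self_le_factorial tendsto_id

theorem ceil_mul_factorial_le {u : ℝ} (hu : u ≤ 1) (j : ℕ) :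
    ⌈u * (j.factorial : ℝ)⌉₊ ≤ j.factorial :=
  Nat.ceil_le.2 (mul_le_of_le_one_left (by positivity) hu)

-- Below `n`, only the last gap begun before `n` matters: it removes at most a proportion `1 - u`,
-- and all earlier gaps lie below a much smaller factorial.
open Classical in
theorem exists_le_count_sparsePositions {u : ℝ} (hu0 : 0 ≤ u) (hu1 : u ≤ 1) {ε : ℝ} (hε : 0 < ε) :
    ∃ C : ℝ, ∀ n : ℕ, (u - ε) * n - C ≤ Nat.count (· ∈ sparsePositions u) n := by
  rcases hu0.eq_or_lt with rfl | hu
  · refine ⟨0, fun n ↦ le_trans ?_ (Nat.cast_nonneg _)⟩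
    have : 0 ≤ ε * n := by positivity
    linarith
  obtain ⟨J, hJ⟩ := exists_nat_gt (1 / (ε * u))
  refine ⟨J.factorial, fun n ↦ ?_⟩
  set p : ℕ → ℕ := fun j ↦ ⌈u * (j.factorial : ℝ)⌉₊ with hp
  have hpmono : Monotone p := fun i j hij ↦ Nat.ceil_mono
    (by have := Nat.factorial_le hij; gcongr)
  have hex : ∃ j, n ≤ p j := by
    obtain ⟨j, hj⟩ := exists_nat_gt (n / u)
    refine ⟨j, ?_⟩
    have h1 : (n : ℝ) ≤ u * j.factorial := by
      rw [div_lt_iff₀ hu] at hj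
      have : (j : ℝ) ≤ j.factorial := by exact_mod_cast Nat.self_le_factorial j
      nlinarith
    exact_mod_cast h1.trans (Nat.le_ceil _)
  have hcount : (n : ℝ) - ((Finset.range n).filter (· ∉ sparsePositions u)).card =
      Nat.count (· ∈ sparsePositions u) n := by
    rw [Nat.count_eq_card_filter_range, sub_eq_iff_eq_add]
    have := Finset.card_filter_add_card_filter_not (s := Finset.range n) (· ∈ sparsePositions u)
    rw [Finset.card_range] at this
    exact_mod_cast this.symm
  rw [← hcount]
  have hn0 : 0 ≤ ε * n := by positivity
  -- `K` is the first gap starting at or after `n`; gap `K - 1`, if it exists, is the one that may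
  -- be cut off by `n`.
  obtain ⟨K, hK, hKmin⟩ : ∃ K, n ≤ p K ∧ ∀ j < K, p j < n :=
    ⟨Nat.find hex, Nat.find_spec hex, fun j hj ↦ not_le.1 (Nat.find_min hex hj)⟩
  rcases K with _ | k
  · have hempty : (Finset.range n).filter (· ∉ sparsePositions u) = ∅ := by
      refine Finset.filter_eq_empty_iff.2 fun i hi ↦ not_not.2 fun j hj ↦ ?_
      have := hpmono (Nat.zero_le j)
      have := Finset.mem_range.1 hi
      simp only [hp] at *
      omega
    rw [hempty]
    have : (0 : ℝ) ≤ J.factorial := by positivity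
    have : u * n ≤ n := mul_le_of_le_one_left (by positivity) hu1
    simp
    linarith
  · have hkn := hKmin k (Nat.lt_succ_self k)
    have hsub : (Finset.range n).filter (· ∉ sparsePositions u) ⊆
        Finset.range (k - 1).factorial ∪ Finset.Ico (p k) (min n k.factorial) := by
      intro i hi
      rw [Finset.mem_filter, Finset.mem_range] at hi
      obtain ⟨hin, hi⟩ := hi
      simp only [sparsePositions, Set.mem_ofPred_eq, not_forall, not_le] at hi
      obtain ⟨j, hj1, hj2⟩ := hi
      have hjk : j ≤ k := by
        by_contra hjk
        have := hpmono (show k + 1 ≤ j by omega)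
        simp only [hp] at *
        omega
      rw [Finset.mem_union, Finset.mem_range, Finset.mem_Ico]
      rcases hjk.eq_or_lt with rfl | hlt
      · exact Or.inr ⟨hj1, lt_min hin hj2⟩
      · exact Or.inl (hj2.trans_le (Nat.factorial_le (by omega)))
    have hcard := (Finset.card_le_card hsub).trans (Finset.card_union_le _ _)
    rw [Finset.card_range, Nat.card_Ico] at hcard
    have hpk : u * k.factorial ≤ p k := Nat.le_ceil _
    have hgap : ((min n k.factorial - p k : ℕ) : ℝ) ≤ (1 - u) * n := by
      rcases le_total (min n k.factorial) (p k) with h | h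
      · rw [Nat.sub_eq_zero_of_le h, Nat.cast_zero]
        exact mul_nonneg (by linarith) (by positivity)
      · rw [Nat.cast_sub h]
        have h1 : ((min n k.factorial : ℕ) : ℝ) ≤ n := by exact_mod_cast min_le_left _ _
        have h2 : ((min n k.factorial : ℕ) : ℝ) ≤ k.factorial := by
          exact_mod_cast min_le_right _ _
        nlinarith
    -- For `k ≥ J` one has `(k - 1)! = k! / k ≤ ε * u * k! ≤ ε * n`; the finitely many smaller `k`
    -- are absorbed in the constant `J!`.
    have hprev : ((k - 1).factorial : ℝ) ≤ ε * n + J.factorial := by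
      rcases le_total k J with h | h
      · have : ((k - 1).factorial : ℝ) ≤ J.factorial := by
          exact_mod_cast Nat.factorial_le (by omega)
        linarith
      · have hJ0 : (0 : ℝ) < J := lt_trans (by positivity) hJ
        have hk0 : 0 < k := lt_of_lt_of_le (by exact_mod_cast hJ0) h
        have hfac : (k : ℝ) * (k - 1).factorial = k.factorial := by
          exact_mod_cast Nat.mul_factorial_pred hk0.ne'
        have hkn' : (p k : ℝ) ≤ n := by exact_mod_cast hkn.le
        have hk1 : 1 ≤ k * (ε * u) := by
          rw [div_lt_iff₀ (by positivity)] at hJ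
          have : (J : ℝ) ≤ k := by exact_mod_cast h
          nlinarith [mul_pos hε hu]
        have hpos : (0 : ℝ) ≤ (k - 1).factorial := by positivity
        have : ((k - 1).factorial : ℝ) ≤ ε * (u * k.factorial) := by
          rw [← hfac]
          nlinarith
        have h3 : ε * (u * k.factorial) ≤ ε * n :=
          mul_le_mul_of_nonneg_left (hpk.trans hkn') hε.le
        have : (0 : ℝ) ≤ J.factorial := by positivity
        linarith
    have hcard' : (((Finset.range n).filter (· ∉ sparsePositions u)).card : ℝ) ≤
        (k - 1).factorial + ((min n k.factorial - p k : ℕ) : ℝ) := by exact_mod_cast hcard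
    linarith

/-- A compact subset of `[0, 1]` of Hausdorff dimension `u`. -/
def sparseSet (u : ℝ) : Set ℝ := digitSet (sparsePositions u)

theorem exists_of_mem_sparseSet {u : ℝ} (hu : u ≤ 1) {x : ℝ} (hx : x ∈ sparseSet u) (j : ℕ) :
    ∃ k : ℕ, k < 2 ^ ⌈u * (j.factorial : ℝ)⌉₊ ∧
      x ∈ Set.Icc (k / 2 ^ ⌈u * (j.factorial : ℝ)⌉₊ : ℝ)
        (k / 2 ^ ⌈u * (j.factorial : ℝ)⌉₊ + (2 ^ j.factorial)⁻¹) :=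
  exists_of_mem_digitSet (S := sparsePositions u) (ceil_mul_factorial_le hu j)
    (fun _ h1 h2 h3 ↦ (h3 j h1).not_gt h2) hx

theorem two_pow_ceil_le {u : ℝ} (hu : 0 ≤ u) (n : ℕ) :
    (2 : ℝ) ^ ⌈u * (n : ℝ)⌉₊ ≤ 2 * 2 ^ (u * n) := by
  have h := (Nat.ceil_lt_add_one (show 0 ≤ u * (n : ℝ) by positivity)).le
  calc (2 : ℝ) ^ ⌈u * (n : ℝ)⌉₊ = 2 ^ ((⌈u * (n : ℝ)⌉₊ : ℕ) : ℝ) := (Real.rpow_natCast _ _).symm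
    _ ≤ 2 ^ (u * n + 1) := Real.rpow_le_rpow_of_exponent_le (by norm_num) h
    _ = 2 * 2 ^ (u * n) := by rw [Real.rpow_add_one (by norm_num), mul_comm]

/-! ### Products of sparse sets -/

section Pi

variable {ι : Type} [Fintype ι]

/-- The gaps of all factors end at the same `j!`, so one scale is efficient for every coordinate at
once. Each ceiling costs a factor `2`, whence the constant. -/
theorem dimH_pi_sparseSet_le {u : ι → ℝ} (hu0 : ∀ i, 0 ≤ u i) (hu1 : ∀ i, u i ≤ 1) :
    dimH (Set.univ.pi fun i ↦ sparseSet (u i)) ≤ ENNReal.ofReal (∑ i, u i) := by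
  classical
  refine dimH_le_of_forall_cover (C := 2 ^ Fintype.card ι)
    (Finset.sum_nonneg fun i _ ↦ hu0 i) (by positivity) tendsto_factorial_atTop
    (ι := fun j ↦ ∀ i, Fin (2 ^ ⌈u i * (j.factorial : ℝ)⌉₊))
    (fun j k ↦ Set.univ.pi fun i ↦ Set.Icc ((k i : ℕ) / 2 ^ ⌈u i * (j.factorial : ℝ)⌉₊ : ℝ)
        ((k i : ℕ) / 2 ^ ⌈u i * (j.factorial : ℝ)⌉₊ + (2 ^ j.factorial)⁻¹)) ?_ ?_ ?_
  · intro j x hx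
    choose k hk1 hk2 using fun i ↦ exists_of_mem_sparseSet (hu1 i) (hx i (Set.mem_univ i)) j
    exact Set.mem_iUnion.2 ⟨fun i ↦ ⟨k i, hk1 i⟩, fun i _ ↦ hk2 i⟩
  · intro j
    calc (Fintype.card (∀ i, Fin (2 ^ ⌈u i * (j.factorial : ℝ)⌉₊)) : ℝ)
        = ∏ i, (2 : ℝ) ^ ⌈u i * (j.factorial : ℝ)⌉₊ := by simp
      _ ≤ ∏ i, 2 * (2 : ℝ) ^ (u i * j.factorial) :=
          Finset.prod_le_prod (fun i _ ↦ by positivity) fun i _ ↦ two_pow_ceil_le (hu0 i) _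
      _ = _ := by
          rw [Finset.prod_mul_distrib, Finset.prod_const, Finset.card_univ, Finset.sum_mul,
            Real.rpow_sum_of_pos (by norm_num)]
  · intro j k
    refine Metric.ediam_pi_le_of_le fun i ↦ ?_
    rw [Real.ediam_Icc, add_sub_cancel_left]
    exact ENNReal.ofReal_le_ofReal
      (le_mul_of_one_le_left (by positivity) (one_le_pow₀ (by norm_num)))

theorem le_dimH_pi_sparseSet {u : ι → ℝ} (hu0 : ∀ i, 0 ≤ u i) (hu1 : ∀ i, u i ≤ 1) :
    ENNReal.ofReal (∑ i, u i) ≤ dimH (Set.univ.pi fun i ↦ sparseSet (u i)) := by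
  classical
  refine le_of_forall_lt fun c hc ↦ ?_
  obtain ⟨e, he1, he2⟩ := exists_between hc
  have hetop : e ≠ ⊤ := (he2.trans ENNReal.ofReal_lt_top).ne
  refine he1.trans_le ?_
  rw [← ENNReal.ofReal_toReal hetop]
  have hd : 0 < e.toReal := ENNReal.toReal_pos (bot_le.trans_lt he1).ne' hetop
  have hdu : e.toReal < ∑ i, u i := by
    rwa [← ENNReal.ofReal_toReal hetop, ENNReal.ofReal_lt_ofReal_iff_of_nonneg hd.le] at he2
  set d := e.toReal
  -- Losing `ε` in each coordinate still leaves a total exponent of at least `d`.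
  set ε := (∑ i, u i - d) / (Fintype.card ι + 1) with hε
  have hε0 : 0 < ε := div_pos (by linarith) (by positivity)
  choose C hC using fun i ↦ exists_le_count_sparsePositions (hu0 i) (hu1 i) hε0
  refine le_dimH_of_forall_measure_le
    (Measure.pi fun i ↦ digitMeasure (sparsePositions (u i))) ?_
    (C := 4 ^ Fintype.card ι * 2 ^ (∑ i, C i)) hd fun n U hU ↦ ?_
  · rw [Measure.pi_pi]
    simp [sparseSet, digitMeasure_digitSet]
  · have hsub : U ⊆ Set.univ.pi fun i ↦ Function.eval i '' U :=
      fun x hx i _ ↦ Set.mem_image_of_mem _ hx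
    refine (measure_mono hsub).trans ?_
    rw [Measure.pi_pi]
    have hfac : ∀ i, digitMeasure (sparsePositions (u i)) (Function.eval i '' U) ≤
        ENNReal.ofReal (4 * (2 ^ (C i) * 2 ^ (-((u i - ε) * n)))) := by
      intro i
      refine (digitMeasure_le _ n (le_trans ?_ hU)).trans ?_
      · simpa using (LipschitzWith.eval i).ediam_image_le U
      · have h4 : (4 : ℝ≥0∞) = ENNReal.ofReal 4 := by simp
        have h2 : (2⁻¹ : ℝ≥0∞) = ENNReal.ofReal 2⁻¹ := by
          rw [ENNReal.ofReal_inv_of_pos (by norm_num)]; simp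
        rw [h4, h2, ← ENNReal.ofReal_pow (by norm_num), ← ENNReal.ofReal_mul (by norm_num)]
        apply ENNReal.ofReal_le_ofReal
        gcongr
        rw [← Real.rpow_add (by norm_num), inv_pow, ← Real.rpow_natCast,
          ← Real.rpow_neg (by norm_num)]
        exact Real.rpow_le_rpow_of_exponent_le (by norm_num) (by linarith [hC i n])
    refine (Finset.prod_le_prod' fun i _ ↦ hfac i).trans ?_
    rw [← ENNReal.ofReal_prod_of_nonneg fun i _ ↦ by positivity]
    apply ENNReal.ofReal_le_ofReal
    rw [Finset.prod_mul_distrib, Finset.prod_mul_distrib, Finset.prod_const, Finset.card_univ,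
      ← Real.rpow_sum_of_pos (by norm_num), ← Real.rpow_sum_of_pos (by norm_num), mul_assoc]
    gcongr
    · norm_num
    · rw [Finset.sum_neg_distrib, ← Finset.sum_mul, Finset.sum_sub_distrib, Finset.sum_const,
        Finset.card_univ, nsmul_eq_mul, neg_le_neg_iff]
      gcongr
      have : (Fintype.card ι + 1) * ε = ∑ i, u i - d := by
        rw [hε]; field_simp
      linarith

theorem dimH_pi_sparseSet {u : ι → ℝ} (hu0 : ∀ i, 0 ≤ u i) (hu1 : ∀ i, u i ≤ 1) :
    dimH (Set.univ.pi fun i ↦ sparseSet (u i)) = ENNReal.ofReal (∑ i, u i) :=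
  (dimH_pi_sparseSet_le hu0 hu1).antisymm (le_dimH_pi_sparseSet hu0 hu1)

end Pi

theorem dimH_sparseSet {u : ℝ} (hu0 : 0 ≤ u) (hu1 : u ≤ 1) :
    dimH (sparseSet u) = ENNReal.ofReal u := by
  have h := dimH_pi_sparseSet (ι := Fin 1) (u := fun _ ↦ u) (fun _ ↦ hu0) (fun _ ↦ hu1)
  rw [← (IsometryEquiv.funUnique (Fin 1) ℝ).dimH_image] at h
  have himg : IsometryEquiv.funUnique (Fin 1) ℝ '' (Set.univ.pi fun _ ↦ sparseSet u) =
      sparseSet u := by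
    ext x
    constructor
    · rintro ⟨f, hf, rfl⟩
      exact hf _ (Set.mem_univ _)
    · exact fun hx ↦ ⟨fun _ ↦ x, fun _ _ ↦ hx, rfl⟩
  rw [himg] at h
  simpa using h

/-- For `u = 0` the gaps `[0, j!)` exhaust all positions. -/
theorem sparseSet_zero : sparseSet 0 = {0} := by
  have hS : sparsePositions 0 = ∅ := by
    refine Set.eq_empty_iff_forall_notMem.2 fun i hi ↦ ?_
    have h1 := hi (i + 1) (by simp)
    have := Nat.self_le_factorial (i + 1)
    omega
  have h0 : Real.ofDigits (fun _ : ℕ ↦ (0 : Fin 2)) = 0 := by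
    simp [Real.ofDigits, Real.ofDigitsTerm]
  ext x
  simp only [sparseSet, hS, digitSet, Set.mem_image, Set.mem_singleton_iff, Set.mem_ofPred_eq,
    Set.mem_empty_iff_false, not_false_eq_true, forall_const]
  constructor
  · rintro ⟨ω, hω, rfl⟩
    rw [funext hω, h0]
  · rintro rfl
    exact ⟨_, fun _ ↦ rfl, h0⟩

/-- If `θ ∈ sparseSet w`, then the grids underlying `sparseSet (v + w)` and `θ • sparseSet v` are
compatible, so that the sum of these sets is small. -/
theorem dimH_sparseSet_add_mul_le {v w θ : ℝ} (hv : 0 ≤ v) (hw : 0 ≤ w) (hvw : v + w ≤ 1)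
    (hθ : θ ∈ sparseSet w) :
    dimH ((fun z : ℝ × ℝ ↦ z.1 + θ * z.2) '' sparseSet (v + w) ×ˢ sparseSet v) ≤
      ENNReal.ofReal (v + w) := by
  -- The grid points lie in `[0, 2]`, hence the count `2 * 2 ^ (p + q)`; the two ceilings bring the
  -- constant to `8`. The length `3 * 2 ^ (-j!)` collects one error from `x` and two from the
  -- product `θ * y`.
  refine dimH_le_of_forall_cover (C := 8) (by positivity) (by norm_num) tendsto_factorial_atTop
    (ι := fun j ↦ Fin (2 * 2 ^ (⌈v * (j.factorial : ℝ)⌉₊ + ⌈w * (j.factorial : ℝ)⌉₊)))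
    (fun j k ↦ Set.Icc
      ((k : ℕ) / 2 ^ (⌈v * (j.factorial : ℝ)⌉₊ + ⌈w * (j.factorial : ℝ)⌉₊) : ℝ)
      ((k : ℕ) / 2 ^ (⌈v * (j.factorial : ℝ)⌉₊ + ⌈w * (j.factorial : ℝ)⌉₊) +
        3 * (2 ^ j.factorial)⁻¹)) ?_ ?_ ?_
  · rintro j _ ⟨⟨x, y⟩, ⟨hx, hy⟩, rfl⟩
    have hy01 := digitSet_subset_Icc _ hy
    obtain ⟨k₁, hk₁, hx1, hx2⟩ := exists_of_mem_sparseSet hvw hx j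
    obtain ⟨k₂, hk₂, hy1, hy2⟩ := exists_of_mem_sparseSet (by linarith) hy j
    obtain ⟨k₃, hk₃, ht1, ht2⟩ := exists_of_mem_sparseSet (by linarith) hθ j
    -- By subadditivity of the ceiling, the grid of `x` is contained in the grid of exponent `p +
    -- q`.
    obtain ⟨c, hc⟩ : ∃ c, ⌈v * (j.factorial : ℝ)⌉₊ + ⌈w * (j.factorial : ℝ)⌉₊ =
        ⌈(v + w) * (j.factorial : ℝ)⌉₊ + c :=
      Nat.exists_eq_add_of_le (by rw [add_mul]; exact Nat.ceil_add_le _ _)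
    set p := ⌈v * (j.factorial : ℝ)⌉₊
    set q := ⌈w * (j.factorial : ℝ)⌉₊
    set r := ⌈(v + w) * (j.factorial : ℝ)⌉₊
    set δ : ℝ := (2 ^ j.factorial)⁻¹ with hδ
    have hδ0 : 0 < δ := by positivity
    have hlt : 2 ^ c * k₁ + k₃ * k₂ < 2 * 2 ^ (p + q) := by
      have h1 : 2 ^ c * k₁ < 2 ^ (p + q) := by
        rw [hc, pow_add, mul_comm]
        gcongr
      have h2 : k₃ * k₂ < 2 ^ (p + q) := by
        rw [add_comm, pow_add]
        exact Nat.mul_lt_mul'' hk₃ hk₂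
      omega
    refine Set.mem_iUnion.2 ⟨⟨2 ^ c * k₁ + k₃ * k₂, hlt⟩, ?_⟩
    have hval : ((2 ^ c * k₁ + k₃ * k₂ : ℕ) : ℝ) / 2 ^ (p + q) =
        k₁ / 2 ^ r + (k₃ / 2 ^ q) * (k₂ / 2 ^ p) := by
      push_cast
      rw [add_div]
      congr 1
      · rw [hc, pow_add]
        field_simp
      · rw [pow_add]
        field_simp
    have hk₃1 : (k₃ : ℝ) / 2 ^ q ≤ 1 := by
      rw [div_le_one (by positivity)]
      exact_mod_cast hk₃.le
    have hk₃0 : 0 ≤ (k₃ : ℝ) / 2 ^ q := by positivity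
    have hk₂0 : 0 ≤ (k₂ : ℝ) / 2 ^ p := by positivity
    change (((2 ^ c * k₁ + k₃ * k₂ : ℕ) : ℝ) / 2 ^ (p + q) ≤ x + θ * y ∧
      x + θ * y ≤ ((2 ^ c * k₁ + k₃ * k₂ : ℕ) : ℝ) / 2 ^ (p + q) + 3 * δ)
    rw [hval]
    constructor
    · have := mul_le_mul ht1 hy1 hk₂0 (hk₃0.trans ht1)
      linarith
    · have h1 : θ * y ≤ (k₃ / 2 ^ q + δ) * y := mul_le_mul_of_nonneg_right ht2 hy01.1
      have h2 : δ * y ≤ δ := mul_le_of_le_one_right hδ0.le hy01.2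
      have h3 : k₃ / 2 ^ q * y ≤ k₃ / 2 ^ q * (k₂ / 2 ^ p + δ) :=
        mul_le_mul_of_nonneg_left hy2 hk₃0
      have h4 : k₃ / 2 ^ q * δ ≤ δ := mul_le_of_le_one_left hδ0.le hk₃1
      linarith
  · intro j
    rw [Fintype.card_fin, add_mul, Real.rpow_add (by norm_num), pow_add]
    push_cast
    calc _ ≤ 2 * ((2 * (2 : ℝ) ^ (v * (j.factorial : ℝ))) * (2 * 2 ^ (w * (j.factorial : ℝ)))) := by
          gcongr
          · exact two_pow_ceil_le hv _
          · exact two_pow_ceil_le hw _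
      _ = _ := by ring
  · intro j k
    rw [Real.ediam_Icc, add_sub_cancel_left]
    apply ENNReal.ofReal_le_ofReal
    gcongr
    norm_num

/-! ### Lines in a coordinate plane -/

/-- A direction vector of slope `θ` in the plane of the first two coordinates. -/
noncomputable def slopeVector (θ : ℝ) : EuclideanSpace ℝ (Fin 3) := !₂[1, θ, 0]

theorem slopeVector_ne_zero (θ : ℝ) : slopeVector θ ≠ 0 := fun h ↦ by
  simpa [slopeVector] using congrArg (fun v : EuclideanSpace ℝ (Fin 3) ↦ v 0) h

/-- The line of slope `θ` in the plane of the first two coordinates. -/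
noncomputable def slopeLine (θ : ℝ) : Grassmannian 1 3 :=
  ⟨ℝ ∙ slopeVector θ, finrank_span_singleton (slopeVector_ne_zero θ)⟩

theorem norm_sq_slopeVector (θ : ℝ) : ‖slopeVector θ‖ ^ 2 = 1 + θ ^ 2 := by
  simp [EuclideanSpace.norm_sq_eq, Fin.sum_univ_three, slopeVector]

theorem projOperator_slopeLine (θ : ℝ) (x : EuclideanSpace ℝ (Fin 3)) :
    (slopeLine θ).projOperator x = ((x 0 + θ * x 1) / (1 + θ ^ 2)) • slopeVector θ := by
  have h := Submodule.starProjection_singleton ℝ (v := slopeVector θ) x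
  rw [show (slopeLine θ).projOperator x = (ℝ ∙ slopeVector θ).starProjection x from rfl, h]
  have hin : inner ℝ (slopeVector θ) x = x 0 + θ * x 1 := by
    simp [PiLp.inner_apply, Fin.sum_univ_three, slopeVector, mul_comm]
  rw [hin]
  congr 2
  simp [norm_sq_slopeVector]

/-- Test the difference of the projections on `w = (-θ', 1, 0)`, which is orthogonal to the second
line. The constant is `2 * 2`, from `‖w‖ ≤ 2` and `1 + θ ^ 2 ≤ 2`. -/
theorem abs_sub_le_dist_slopeLine {θ θ' : ℝ} (hθ : θ ∈ Set.Icc (0 : ℝ) 1)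
    (hθ' : θ' ∈ Set.Icc (0 : ℝ) 1) :
    |θ - θ'| ≤ 4 * dist (slopeLine θ) (slopeLine θ') := by
  set w : EuclideanSpace ℝ (Fin 3) := !₂[-θ', 1, 0] with hw
  have hwn : ‖w‖ ≤ 2 := by
    have : ‖w‖ ^ 2 = θ' ^ 2 + 1 := by
      simp [EuclideanSpace.norm_sq_eq, Fin.sum_univ_three, hw]
    nlinarith [hθ'.1, hθ'.2, norm_nonneg w]
  have h0 : (slopeLine θ').projOperator w = 0 := by
    rw [projOperator_slopeLine]
    simp [hw]
  have h1 : ((slopeLine θ).projOperator w) 0 = (θ - θ') / (1 + θ ^ 2) := by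
    rw [projOperator_slopeLine]
    simp [hw, slopeVector]
    ring
  have h2 : |(θ - θ') / (1 + θ ^ 2)| ≤ dist (slopeLine θ) (slopeLine θ') * 2 := by
    calc |(θ - θ') / (1 + θ ^ 2)| = ‖((slopeLine θ).projOperator w) 0‖ := by
          rw [h1, Real.norm_eq_abs]
      _ ≤ ‖(slopeLine θ).projOperator w‖ := PiLp.norm_apply_le _ _
      _ = ‖((slopeLine θ).projOperator - (slopeLine θ').projOperator) w‖ := by
          rw [sub_apply, h0, sub_zero]
      _ ≤ ‖(slopeLine θ).projOperator - (slopeLine θ').projOperator‖ * ‖w‖ :=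
          ContinuousLinearMap.le_opNorm _ _
      _ ≤ _ := by
          rw [← dist_eq_norm]
          exact mul_le_mul_of_nonneg_left hwn dist_nonneg
  rw [abs_div, abs_of_pos (show 0 < 1 + θ ^ 2 by positivity), div_le_iff₀ (by positivity)] at h2
  nlinarith [hθ.1, hθ.2, dist_nonneg (x := slopeLine θ) (y := slopeLine θ'),
    mul_nonneg (dist_nonneg (x := slopeLine θ) (y := slopeLine θ'))
      (show 0 ≤ 1 - θ ^ 2 by nlinarith [hθ.1, hθ.2])]

theorem dimH_le_dimH_image_slopeLine {D : Set ℝ} (hD : D ⊆ Set.Icc 0 1) :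
    dimH D ≤ dimH (slopeLine '' D) := by
  have hanti : AntilipschitzWith 4 fun θ : D ↦ slopeLine θ :=
    AntilipschitzWith.of_le_mul_dist fun θ θ' ↦ by
      rw [Subtype.dist_eq, Real.dist_eq]
      exact abs_sub_le_dist_slopeLine (hD θ.2) (hD θ'.2)
  have h := hanti.le_dimH_image Set.univ
  rw [← (isometry_subtype_coe (s := D)).dimH_image] at h
  rwa [Set.image_univ, Set.image_univ, Subtype.range_coe, ← Set.image_eq_range] at h

theorem dimH_orthogonalProjectionOnto_slopeLine_le (θ : ℝ) (A : Set (EuclideanSpace ℝ (Fin 3))) :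
    dimH ((slopeLine θ).1.orthogonalProjectionOnto '' A) ≤
      dimH ((fun x : EuclideanSpace ℝ (Fin 3) ↦ x 0 + θ * x 1) '' A) := by
  rw [← (slopeLine θ).1.subtypeₗᵢ.isometry.dimH_image, Set.image_image]
  have hlip : LipschitzWith ‖slopeVector θ‖₊ fun c : ℝ ↦ (c / (1 + θ ^ 2)) • slopeVector θ := by
    refine LipschitzWith.of_dist_le_mul fun c c' ↦ ?_
    rw [dist_eq_norm, ← sub_smul, norm_smul, mul_comm, coe_nnnorm, ← sub_div, norm_div,
      dist_eq_norm]
    gcongr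
    refine div_le_self (norm_nonneg _) ?_
    rw [Real.norm_eq_abs, abs_of_pos (by positivity)]
    nlinarith [sq_nonneg θ]
  refine le_trans (le_of_eq ?_) (hlip.dimH_image_le _)
  rw [Set.image_image]
  exact congrArg dimH (Set.image_congr fun x _ ↦ projOperator_slopeLine θ x)

/-! ### Boxes of sparse sets -/

/-- The product of three sparse sets, of dimension `u + v + w`. -/
def sparseBox (u v w : ℝ) : Set (EuclideanSpace ℝ (Fin 3)) :=
  {x | x 0 ∈ sparseSet u ∧ x 1 ∈ sparseSet v ∧ x 2 ∈ sparseSet w}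

theorem measurableSet_sparseBox (u v w : ℝ) : MeasurableSet (sparseBox u v w) := by
  have h (t : ℝ) (i : Fin 3) : MeasurableSet {x : EuclideanSpace ℝ (Fin 3) | x i ∈ sparseSet t} :=
    (EuclideanSpace.proj (𝕜 := ℝ) i).continuous.measurable
      (isCompact_digitSet (sparsePositions t)).measurableSet
  exact (h u 0).inter ((h v 1).inter (h w 2))

theorem dimH_sparseBox {u v w : ℝ} (hu : u ∈ Set.Icc (0 : ℝ) 1) (hv : v ∈ Set.Icc (0 : ℝ) 1)
    (hw : w ∈ Set.Icc (0 : ℝ) 1) : dimH (sparseBox u v w) = ENNReal.ofReal (u + v + w) := by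
  have h := dimH_pi_sparseSet (u := ![u, v, w])
    (fun i ↦ by fin_cases i <;> simp [hu.1, hv.1, hw.1])
    (fun i ↦ by fin_cases i <;> simp [hu.2, hv.2, hw.2])
  rw [← (EuclideanSpace.equiv (Fin 3) ℝ).dimH_preimage, Fin.sum_univ_three] at h
  convert! h using 2
  ext x
  simp [sparseBox, Fin.forall_fin_succ]

/-- If the lines with slope in `sparseSet w` are exceptional for `A`, then the exceptional set has
dimension at least `w`. -/
theorem ofReal_le_exceptionalDim {a s c w : ℝ} (hw : w ∈ Set.Icc (0 : ℝ) 1)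
    {A : Set (EuclideanSpace ℝ (Fin 3))} (hA : MeasurableSet A) (hdim : dimH A = ENNReal.ofReal a)
    (hs : 0 < s) (hcs : c < s)
    (hproj : ∀ θ ∈ sparseSet w,
      dimH ((fun x : EuclideanSpace ℝ (Fin 3) ↦ x 0 + θ * x 1) '' A) ≤ ENNReal.ofReal c) :
    ENNReal.ofReal w ≤ exceptionalDim 1 3 a s := by
  rw [← dimH_sparseSet hw.1 hw.2]
  refine (dimH_le_dimH_image_slopeLine (digitSet_subset_Icc _)).trans ?_
  refine le_trans (dimH_mono ?_) (le_iSup₂_of_le A hA (le_iSup_of_le hdim le_rfl))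
  rintro _ ⟨θ, hθ, rfl⟩
  exact ((dimH_orthogonalProjectionOnto_slopeLine_le θ A).trans (hproj θ hθ)).trans_lt
    ((ENNReal.ofReal_lt_ofReal_iff hs).2 hcs)

/-- In the box with factors of dimensions `u`, `0`, `w`, every slope in `[0, 1]` sees only
`sparseSet u`. -/
theorem one_le_exceptionalDim {u w s : ℝ} (hu : u ∈ Set.Icc (0 : ℝ) 1)
    (hw : w ∈ Set.Icc (0 : ℝ) 1) (hus : u < s) : 1 ≤ exceptionalDim 1 3 (u + w) s := by
  rw [← ENNReal.ofReal_one]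
  have hdim := dimH_sparseBox hu (v := 0) (by simp) hw
  rw [add_zero] at hdim
  refine ofReal_le_exceptionalDim (by simp) (measurableSet_sparseBox u 0 w) hdim
    (hu.1.trans_lt hus) hus fun θ _ ↦ ?_
  rw [← dimH_sparseSet hu.1 hu.2]
  refine dimH_mono ?_
  rintro _ ⟨x, ⟨hx, hy, -⟩, rfl⟩
  rw [sparseSet_zero, Set.mem_singleton_iff] at hy
  simpa [hy] using hx

theorem ofReal_two_mul_sub_le_exceptionalDim {t s : ℝ} (hts : t < 2 * s) (hst : s ≤ t)
    (hs1 : s < 1) : ENNReal.ofReal (2 * s - t) ≤ exceptionalDim 1 3 (t + 1) s := by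
  -- The exceptional set requires projections of dimension strictly below `s`, so `r = s` is reached
  -- only as a limit; `r > t / 2` keeps `2 * r - t` positive.
  have hmain : ∀ r ∈ Set.Ioo (t / 2) s,
      ENNReal.ofReal (2 * r - t) ≤ exceptionalDim 1 3 (t + 1) s := by
    rintro r ⟨hr1, hr2⟩
    have hdim := dimH_sparseBox (u := r) (v := t - r) (w := 1) ⟨by linarith, by linarith⟩
      ⟨by linarith, by linarith⟩ (by simp)
    rw [add_sub_cancel] at hdim
    refine ofReal_le_exceptionalDim ⟨by linarith, by linarith⟩ (measurableSet_sparseBox _ _ _) hdim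
      (by linarith) hr2 fun θ hθ ↦ ?_
    have hsum : t - r + (2 * r - t) = r := by ring
    have h := dimH_sparseSet_add_mul_le (v := t - r) (w := 2 * r - t) (by linarith) (by linarith)
      (by linarith) hθ
    rw [hsum] at h
    refine le_trans (dimH_mono ?_) h
    rintro _ ⟨x, ⟨hx, hy, -⟩, rfl⟩
    exact ⟨(x 0, x 1), ⟨hx, hy⟩, rfl⟩
  have hlim : Tendsto (fun r : ℝ ↦ ENNReal.ofReal (2 * r - t)) (𝓝[<] s)
      (𝓝 (ENNReal.ofReal (2 * s - t))) :=
    ((ENNReal.continuous_ofReal.comp (by fun_prop : Continuous fun r : ℝ ↦ 2 * r - t)).tendsto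
      s).mono_left nhdsWithin_le_nhds
  exact le_of_tendsto hlim (eventually_of_mem (Ioo_mem_nhdsLT (by linarith)) hmain)

theorem proposition6p4 (a s : ℝ) (hs : 0 < s) (hsa : s < min 1 a) :
    (a ≤ 1 → 1 ≤ exceptionalDim 1 3 a s) ∧
    (1 < a → a ≤ 2 →
      (s ≤ (a - 1) / 2 → 0 ≤ exceptionalDim 1 3 a s) ∧
      ((a - 1) / 2 < s → s ≤ a - 1 →
        ENNReal.ofReal (1 + 2 * s - a) ≤ exceptionalDim 1 3 a s) ∧
      (a - 1 < s → 1 ≤ exceptionalDim 1 3 a s)) ∧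
    (2 < a → a ≤ 3 →
      (s ≤ (a - 1) / 2 → 0 ≤ exceptionalDim 1 3 a s) ∧
      ((a - 1) / 2 < s →
        ENNReal.ofReal (1 + 2 * s - a) ≤ exceptionalDim 1 3 a s)) := by
  obtain ⟨hs1, hsa⟩ := lt_min_iff.1 hsa
  -- This serves both ranges of `a`: when `a > 2`, `s ≤ a - 1` follows from `s < 1`.
  have hmid : (a - 1) / 2 < s → s ≤ a - 1 →
      ENNReal.ofReal (1 + 2 * s - a) ≤ exceptionalDim 1 3 a s := fun h1 h2 ↦ by
    have h := ofReal_two_mul_sub_le_exceptionalDim (t := a - 1) (by linarith) h2 hs1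
    rwa [sub_add_cancel, show 2 * s - (a - 1) = 1 + 2 * s - a by ring] at h
  refine ⟨fun ha ↦ ?_, fun ha1 ha2 ↦ ⟨fun _ ↦ zero_le, hmid, fun h ↦ ?_⟩,
    fun ha2 ha3 ↦ ⟨fun _ ↦ zero_le, fun h ↦ hmid h (by linarith)⟩⟩
  · have h := one_le_exceptionalDim (u := 0) (w := a) (by simp) ⟨by linarith, ha⟩ hs
    rwa [zero_add] at h
  · have h := one_le_exceptionalDim (u := a - 1) (w := 1) ⟨by linarith, by linarith⟩ (by simp) h
    rwa [sub_add_cancel] at h
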